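/- **Theorem B.** Let $(M,g)$ be a Malament–Hogarth spacetime: a time-oriented four-dimensional Lorentz manifold with a future-directed timelike half-curve of infinite proper time that lies in the chronological past $I^-(p)$ of a single point $p$ (for instance the Kerr spacetimes of Etesi and Németi, or any $\mathrm{SAD}_1$ spacetime). Consider decision procedures of the following kind. An observer $O_r$ travels along such a half-curve $\gamma_1$ and runs one computing machine (Turing machine) on an input $n\in\mathbb N$ for ever, each step taking a fixed proper time. The machine may at some steps send signals (finite messages), but only finitely many on each input. They are received, without overtaking each other, by an observer $O_p$ at or before the end $p$ of a future-directed timelike curve $\gamma_2$ of finite proper time that starts in the causal future of the starting point of $\gamma_1$; then $O_p$ answers the question "$n\in R$?" by a computable function of $n$ and of the list of messages received. For $B\in\mathbb N\cup\{\infty\}$ let $\mathcal D_B$ be the class of all $R\subseteq\mathbb N$ decidable in this way with at most $B$ signals on every input ($B=\infty$: finitely many signals on each input, with no bound fixed in advance). Let $\Delta_2=\Sigma_2\cap\Pi_2$ be the class of $\Delta_2$ subsets of $\mathbb N$ in the arithmetical hierarchy. Then: 1. For every $B\in\mathbb N\cup\{\infty\}$ we have $\mathcal D_B\subseteq\Delta_2$,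 and $\mathcal D_B$ is a proper subclass of $\Delta_2$ if and only if $B<\infty$. 2. $\bigcup_{k\in\mathbb N}\mathcal D_k$ is the class of all finite Boolean combinations of $\Sigma_1$ and $\Pi_1$ subsets of $\mathbb N$, and it is still a proper subclass of $\Delta_2$. 3. $\mathcal D_\infty=\Delta_2$, and this is also the class of trial and error predicates (Putnam, Gold), i.e. of those $R\subseteq\mathbb N$ for which there are two machines $M_0,M_1$, each with an output tape that is blank or holds one digit $0$ or $1$ and whose content changes only finitely often on each input, such that for all $n$: $n\in R$ if and only if the eventual output of $M_0$ on $n$ is $1$, and $n\notin R$ if and only if the eventual output of $M_1$ on $n$ is $0$. -/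

import Mathlib

open Set Filter Topology MeasureTheory Manifold
open scoped ENNReal ContDiff

/-! ### The arithmetical hierarchy -/

/-- `IsSigma m k P`: the relation `P ⊆ ℕ^k` is `Σ_m`. A `Σ_0` relation is a recursive one, and a
`Σ_{m+1}` relation is a projection `{a | ∃ b, (b, a) ∈ Q}` of a `Π_m` relation `Q`, that is, of a
relation `Q` whose complement is `Σ_m`. -/
def IsSigma : ℕ → (k : ℕ) → Set (List.Vector ℕ k) → Prop
  | 0, _, P => ComputablePred fun a => a ∈ P
  | m + 1, k, P => ∃ Q : Set (List.Vector ℕ (k + 1)),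
      IsSigma m (k + 1) Qᶜ ∧ P = {a | ∃ b : ℕ, List.Vector.cons b a ∈ Q}

/-- `P ⊆ ℕ^k` is `Π_m` if its complement is `Σ_m`. -/
def IsPi (m k : ℕ) (P : Set (List.Vector ℕ k)) : Prop := IsSigma m k Pᶜ

/-- A set of natural numbers, regarded as a unary relation. -/
def unary (R : Set ℕ) : Set (List.Vector ℕ 1) := {a | a.head ∈ R}

/-- The sets of natural numbers that are `Σ_1`. -/
def SigmaOneSets : Set (Set ℕ) := {R | IsSigma 1 1 (unary R)}

/-- The sets of natural numbers that are `Δ_2`, i.e. both `Σ_2` and `Π_2`. -/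
def DeltaTwoSets : Set (Set ℕ) := {R | IsSigma 2 1 (unary R) ∧ IsPi 2 1 (unary R)}

/-! ### Machines running for ever -/

/-- A deterministic computing machine, run without end. Configurations are coded by natural
numbers; the initial configuration on an input, the effect of one computation step on a
configuration, and the visible symbol attached to a configuration are primitive recursive
(as they are for every Turing machine). -/
structure Machine (σ : Type) [Primcodable σ] where
  /-- the initial configuration on a given input -/
  start : ℕ → ℕ
  /-- one computation step -/
  next : ℕ → ℕ
  /-- the visible symbol in a given configuration -/
  out : ℕ → σ
  start_primrec : Primrec start
  next_primrec : Primrec next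
  out_primrec : Primrec out

namespace Machine

variable {σ : Type} [Primcodable σ]

/-- What the machine `M`, started on input `n`, shows after `s` steps. -/
def output (M : Machine σ) (n s : ℕ) : σ := M.out (M.next^[s] (M.start n))

/-- For a machine which at each step either sends a signal, carrying a finite message (coded by a
natural number), or sends nothing (`none`): the list of messages sent at the steps before `s`. -/
def log (M : Machine (Option ℕ)) (n s : ℕ) : List ℕ := (List.range s).filterMap (M.output n)

/-- On input `n` the machine sends altogether only finitely many signals, and `L` is the complete
list of their messages, in the order of sending. -/
def Sends (M : Machine (Option ℕ)) (n : ℕ) (L : List ℕ) : Prop :=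
  ∃ s₀, ∀ s, s₀ ≤ s → M.log n s = L

/-- For a machine with an output tape that is blank (`none`) or holds a single digit
(`some false` for `0`, `some true` for `1`), which may be changed later: on each input the content
of the output tape changes only finitely often. -/
def FinitelyManyChanges (M : Machine (Option Bool)) : Prop :=
  ∀ n, {s | M.output n (s + 1) ≠ M.output n s}.Finite

/-- The eventual content of the output tape on input `n` is `v`. -/
def EventualValue (M : Machine (Option Bool)) (n : ℕ) (v : Option Bool) : Prop :=
  ∀ᶠ s in atTop, M.output n s = v

end Machine

/-- Trial and error predicates (Putnam, Gold). -/
def IsTrialAndError (R : Set ℕ) : Prop :=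
  ∃ M₀ M₁ : Machine (Option Bool), M₀.FinitelyManyChanges ∧ M₁.FinitelyManyChanges ∧
    ∀ n, (n ∈ R ↔ M₀.EventualValue n (some true)) ∧ (n ∉ R ↔ M₁.EventualValue n (some false))

/-! ### Spacetimes -/

/-- A spacetime structure on a four-dimensional smooth manifold `M`: a smooth Lorentz metric of
signature `(-,+,+,+)` and a time orientation, given by a continuous timelike vector field. -/
structure Spacetime (M : Type*) [TopologicalSpace M] [ChartedSpace (EuclideanSpace ℝ (Fin 4)) M]
    [IsManifold (𝓡 4) ∞ M] where
  /-- the metric tensor -/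
  metric : ∀ x : M, TangentSpace (𝓡 4) x →L[ℝ] TangentSpace (𝓡 4) x →L[ℝ] ℝ
  metric_symm : ∀ x v w, metric x v w = metric x w v
  /-- Lorentz signature: the orthogonal complement of some timelike vector is positive definite -/
  metric_lorentz : ∀ x, ∃ v, metric x v v < 0 ∧ ∀ w, metric x v w = 0 → w ≠ 0 → 0 < metric x w w
  metric_smooth : ContMDiff (𝓡 4)
    ((𝓡 4).prod 𝓘(ℝ, EuclideanSpace ℝ (Fin 4) →L[ℝ] EuclideanSpace ℝ (Fin 4) →L[ℝ] ℝ)) ∞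
    (fun x => Bundle.TotalSpace.mk'
      (EuclideanSpace ℝ (Fin 4) →L[ℝ] EuclideanSpace ℝ (Fin 4) →L[ℝ] ℝ) x (metric x))
  /-- the future-pointing timelike vector field that gives the time orientation -/
  orientation : ∀ x : M, TangentSpace (𝓡 4) x
  orientation_timelike : ∀ x, metric x (orientation x) (orientation x) < 0
  orientation_continuous : Continuous fun x =>
    (Bundle.TotalSpace.mk' (EuclideanSpace ℝ (Fin 4)) x (orientation x) : TangentBundle (𝓡 4) M)

namespace Spacetime

variable {M : Type*} [TopologicalSpace M] [ChartedSpace (EuclideanSpace ℝ (Fin 4)) M]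
  [IsManifold (𝓡 4) ∞ M]

/-- The velocity at parameter `t` of a curve with parameter interval `J`. -/
noncomputable def velocity (γ : ℝ → M) (J : Set ℝ) (t : ℝ) : TangentSpace (𝓡 4) (γ t) :=
  mfderivWithin 𝓘(ℝ, ℝ) (𝓡 4) γ J t (1 : ℝ)

/-- `γ`, restricted to the interval `J`, is a future-directed timelike (`C^1`) curve. -/
def IsTimelikeCurve (S : Spacetime M) (γ : ℝ → M) (J : Set ℝ) : Prop :=
  ContMDiffOn 𝓘(ℝ, ℝ) (𝓡 4) 1 γ J ∧ ∀ t ∈ J,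
    S.metric (γ t) (velocity γ J t) (velocity γ J t) < 0 ∧
    S.metric (γ t) (S.orientation (γ t)) (velocity γ J t) < 0

/-- `γ`, restricted to the interval `J`, is a future-directed causal (timelike or null)
(`C^1`) curve. -/
def IsCausalCurve (S : Spacetime M) (γ : ℝ → M) (J : Set ℝ) : Prop :=
  ContMDiffOn 𝓘(ℝ, ℝ) (𝓡 4) 1 γ J ∧ ∀ t ∈ J, velocity γ J t ≠ 0 ∧
    S.metric (γ t) (velocity γ J t) (velocity γ J t) ≤ 0 ∧
    S.metric (γ t) (S.orientation (γ t)) (velocity γ J t) < 0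

/-- The chronological past `I⁻(p)`: all points from which a future-directed timelike curve
leads to `p`. -/
def chronologicalPast (S : Spacetime M) (p : M) : Set M :=
  {q | ∃ γ : ℝ → M, S.IsTimelikeCurve γ (Icc 0 1) ∧ γ 0 = q ∧ γ 1 = p}

/-- The causal future `J⁺(q)`: `q` itself and all points to which a future-directed causal curve
leads from `q`. -/
def causalFuture (S : Spacetime M) (q : M) : Set M :=
  {p | p = q ∨ ∃ γ : ℝ → M, S.IsCausalCurve γ (Icc 0 1) ∧ γ 0 = q ∧ γ 1 = p}

/-- The proper time `∫ dτ`, possibly infinite, along the part with parameters in `K` of a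
timelike curve `γ` with parameter interval `J`. -/
noncomputable def properTime (S : Spacetime M) (γ : ℝ → M) (J K : Set ℝ) : ℝ≥0∞ :=
  ∫⁻ t in K, ENNReal.ofReal (√(-S.metric (γ t) (velocity γ J t) (velocity γ J t)))

/-- Malament-Hogarth spacetimes: some timelike half-curve of infinite proper time lies entirely in
the chronological past of a single point. -/
def IsMalamentHogarth (S : Spacetime M) : Prop :=
  ∃ (γ : ℝ → M) (p : M), S.IsTimelikeCurve γ (Ici 0) ∧ S.properTime γ (Ici 0) (Ici 0) = (⊤ : ℝ≥0∞) ∧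
    γ '' Ici 0 ⊆ S.chronologicalPast p

/-- The arrangement by which one machine is used in a Malament-Hogarth spacetime. An observer
`O_r` moves for ever, for an infinite proper time, along `γ₁` and carries the machine; each
computation step takes the same amount of proper time. An observer `O_p` moves along `γ₂`, reaching
in a finite proper time a point `p` which has all of `γ₁` in its chronological past. -/
structure Arrangement (S : Spacetime M) where
  /-- the world line of `O_r` -/
  γ₁ : ℝ → M
  /-- the world line of `O_p` -/
  γ₂ : ℝ → M
  /-- the point by which `O_p` knows the answer -/
  p : M
  γ₁_timelike : S.IsTimelikeCurve γ₁ (Ici 0)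
  γ₁_infinite : S.properTime γ₁ (Ici 0) (Ici 0) = (⊤ : ℝ≥0∞)
  γ₁_past : γ₁ '' Ici 0 ⊆ S.chronologicalPast p
  γ₂_timelike : S.IsTimelikeCurve γ₂ (Icc 0 1)
  γ₂_start : γ₂ 0 ∈ S.causalFuture (γ₁ 0)
  γ₂_end : γ₂ 1 = p
  γ₂_finite : S.properTime γ₂ (Icc 0 1) (Icc 0 1) < (⊤ : ℝ≥0∞)
  /-- the proper time taken by one computation step -/
  duration : ℝ
  duration_pos : 0 < duration
  /-- the curve parameter on `γ₁` at which step number `s` takes place -/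
  step : ℕ → ℝ
  step_nonneg : ∀ s, 0 ≤ step s
  step_time : ∀ s, S.properTime γ₁ (Ici 0) (Icc 0 (step s)) = ENNReal.ofReal (s * duration)

/-- When `O_r` runs the machine `P` on input `n`, it sends only finitely many signals, each of them
reaches `O_p` on `γ₂` at or before the point `p` without overtaking an earlier one, and `L` is the
complete list of the messages that `O_p` has then received. Here `recv s` is the curve parameter
on `γ₂` at which the signal sent at step number `s`, if any, is received. -/
def Arrangement.Receives {S : Spacetime M} (A : S.Arrangement) (P : Machine (Option ℕ)) (n : ℕ)
    (L : List ℕ) : Prop :=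
  P.Sends n L ∧ ∃ recv : ℕ → ℝ, MonotoneOn recv {s | P.output n s ≠ none} ∧
    ∀ s, P.output n s ≠ none →
      recv s ∈ Icc (0 : ℝ) 1 ∧ A.γ₂ (recv s) ∈ S.causalFuture (A.γ₁ (A.step s))

/-- `S.decidableSets B` is the class of all `R ⊆ ℕ` that can be decided in the spacetime `S` by
one machine in an arrangement as above that sends, on every input, finitely many and
at most `B` signals (`B = ⊤`: finitely many, without any bound fixed in advance). The answer to the
question whether `n ∈ R` is computed from `n` and from the list of messages that `O_p` has
received on reaching `p`. -/
def decidableSets (S : Spacetime M) (B : ℕ∞) : Set (Set ℕ) :=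
  {R | ∃ (A : S.Arrangement) (P : Machine (Option ℕ)) (D : ℕ → List ℕ → Bool), Computable₂ D ∧
      ∀ n, ∃ L, A.Receives P n L ∧ (L.length : ℕ∞) ≤ B ∧ (n ∈ R ↔ D n L = true)}

end Spacetime

/-! Geometry enters only through `IsMalamentHogarth.decidableSets_eq`. Every event of `γ₁` lies in
the chronological past of `p`, so all signals can be received at `p` itself, and arrangements exist
because proper time along a half-curve of infinite length takes every nonnegative value. What
remains is recursion theory about the logs of machines.

Upper bound: the answer computed from the messages sent so far is a computable approximation that is
eventually correct, and such limits are `Δ₂`. Conversely, for a `Δ₂` set, merge the `Σ₂` witnesses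
for `R` (even numbers) with those for its complement (odd numbers). A true witness is a number on
which some code `e` does not halt (`exists_code_of_mem_deltaTwoSets`). The search `searchState`
keeps a candidate until `e` is seen to halt on it; it settles (`exists_searchState_eq`), and the
parity of the final candidate decides membership. One signal per rejected candidate gives
`signalDecidableSets ⊤`; displaying the current parity gives a trial and error predicate.

With at most `k` signals, the possible final counts `0, …, k` write `R` as a union of `k + 1`
differences of `Σ₁` sets (`exists_codes_of_mem_signalDecidableSets`), a Boolean combination.
Conversely, a `Σ₁` set needs one signal, complements cost nothing, and bounds add under unions.
Diagonalising against all coded finite unions of differences yields one `Δ₂` set outside every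
bounded class. -/

/-! ### Proper time along curves -/

/-- Intermediate value theorem for the primitive of `f`, which is continuous and, the total integral
being infinite, exceeds `c`. -/
theorem exists_setLIntegral_Icc_eq {f : ℝ → ℝ} (hf : ContinuousOn f (Ici 0))
    (hf₀ : ∀ t ∈ Ici (0 : ℝ), 0 ≤ f t)
    (htop : ∫⁻ t in Ici (0 : ℝ), ENNReal.ofReal (f t) = ⊤) {c : ℝ} (hc : 0 ≤ c) :
    ∃ T, 0 ≤ T ∧ ∫⁻ t in Icc 0 T, ENNReal.ofReal (f t) = ENNReal.ofReal c := by
  -- Extending `f` by the constant `f 0` to the left makes it continuous on the whole line.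
  set g : ℝ → ℝ := fun t => f (max 0 t) with hg
  have hgc : Continuous g :=
    hf.comp_continuous (continuous_const.max continuous_id) fun t => mem_Ici.2 (le_max_left _ _)
  have hgf : ∀ t ∈ Ici (0 : ℝ), f t = g t := fun t ht => by simp [hg, max_eq_right (mem_Ici.1 ht)]
  have hg₀ : ∀ t, 0 ≤ g t := fun t => hf₀ _ (mem_Ici.2 (le_max_left _ _))
  have key : ∀ T, 0 ≤ T → ∫⁻ t in Icc 0 T, ENNReal.ofReal (f t) =
      ENNReal.ofReal (∫ t in (0 : ℝ)..T, g t) := by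
    intro T hT
    rw [setLIntegral_congr_fun measurableSet_Icc fun t ht => by rw [hgf t ht.1],
      intervalIntegral.integral_of_le hT, ← integral_Icc_eq_integral_Ioc,
      ofReal_integral_eq_lintegral_ofReal (hgc.integrableOn_Icc) (ae_of_all _ hg₀)]
  have hcont : Continuous fun T => ∫ t in (0 : ℝ)..T, g t :=
    intervalIntegral.continuous_primitive (fun a b => hgc.intervalIntegrable a b) 0
  obtain ⟨N, hN⟩ : ∃ N : ℕ, c ≤ ∫ t in (0 : ℝ)..N, g t := by
    -- If the primitive stayed below `c`, monotone convergence over the intervals `[0, N]` would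
    -- bound the total integral by `c`.
    by_contra! hlt
    have hU : (⋃ N : ℕ, Icc (0 : ℝ) N) = Ici 0 := by
      ext t
      simp only [mem_iUnion, mem_Icc, exists_and_left, mem_Ici, and_iff_left_iff_imp]
      exact fun _ => exists_nat_ge t
    have hmono : Monotone fun N : ℕ => Icc (0 : ℝ) N := fun a b hab =>
      Icc_subset_Icc_right (by exact_mod_cast hab)
    rw [← hU, setLIntegral_iUnion_of_directed _ hmono.directed_le] at htop
    refine ENNReal.ofReal_ne_top (r := c) (top_le_iff.1 (htop ▸ iSup_le fun N => ?_))
    rw [key N N.cast_nonneg]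
    exact ENNReal.ofReal_le_ofReal (hlt N).le
  obtain ⟨T, hT, hTc⟩ := intermediate_value_Icc (N.cast_nonneg (α := ℝ)) hcont.continuousOn
    (show c ∈ Icc _ _ from ⟨by simpa using hc, hN⟩)
  exact ⟨T, hT.1, by rw [key T hT.1]; exact congrArg _ hTc⟩

namespace Spacetime

variable {M : Type*} [TopologicalSpace M] [ChartedSpace (EuclideanSpace ℝ (Fin 4)) M]
  [IsManifold (𝓡 4) ∞ M]

theorem continuousOn_velocity {γ : ℝ → M} {J : Set ℝ} (hγ : ContMDiffOn 𝓘(ℝ, ℝ) (𝓡 4) 1 γ J)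
    (hJ : UniqueDiffOn ℝ J) :
    ContinuousOn (fun t => (Bundle.TotalSpace.mk' (EuclideanSpace ℝ (Fin 4)) (γ t)
      (velocity γ J t) : TangentBundle (𝓡 4) M)) J := by
  have : IsManifold (𝓡 4) 1 M := IsManifold.of_le (n := ∞) (by simp)
  have h := hγ.continuousOn_tangentMapWithin le_rfl hJ.uniqueMDiffOn
  have h1 : Continuous fun t : ℝ => (⟨t, (1 : ℝ)⟩ : TangentBundle 𝓘(ℝ, ℝ) ℝ) :=
    (tangentBundleModelSpaceHomeomorph 𝓘(ℝ, ℝ)).symm.continuous.comp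
      (continuous_id.prodMk continuous_const)
  exact h.comp h1.continuousOn fun t ht => ht

theorem continuousOn_metric_velocity (S : Spacetime M) {γ : ℝ → M} {J : Set ℝ}
    (hγ : ContMDiffOn 𝓘(ℝ, ℝ) (𝓡 4) 1 γ J) (hJ : UniqueDiffOn ℝ J) :
    ContinuousOn (fun t => S.metric (γ t) (velocity γ J t) (velocity γ J t)) J := by
  have : IsManifold (𝓡 4) 1 M := IsManifold.of_le (n := ∞) (by simp)
  intro t ht
  -- Continuity is stated as regularity of order `0`, so that the smooth bundle lemma for evaluating
  -- a bilinear form on two sections applies.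
  have hv : ContMDiffWithinAt 𝓘(ℝ, ℝ) ((𝓡 4).prod 𝓘(ℝ, EuclideanSpace ℝ (Fin 4))) 0
      (fun t => (Bundle.TotalSpace.mk' (EuclideanSpace ℝ (Fin 4)) (γ t)
        (velocity γ J t) : TangentBundle (𝓡 4) M)) J t :=
    contMDiffOn_zero_iff.2 (continuousOn_velocity hγ hJ) t ht
  have : ContMDiffWithinAt 𝓘(ℝ, ℝ) ((𝓡 4).prod 𝓘(ℝ, ℝ)) 0
      (fun t => Bundle.TotalSpace.mk' ℝ (E := Bundle.Trivial M ℝ) (γ t)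
        (S.metric (γ t) (velocity γ J t) (velocity γ J t))) J t := by
    apply ContMDiffWithinAt.clm_bundle_apply₂ (F₁ := EuclideanSpace ℝ (Fin 4))
      (F₂ := EuclideanSpace ℝ (Fin 4))
    · exact ContMDiffAt.comp_contMDiffWithinAt t
        ((S.metric_smooth.of_le (by simp)).contMDiffAt) ((hγ t ht).of_le (by simp))
    · exact hv
    · exact hv
  simp only [Bundle.contMDiffWithinAt_totalSpace] at this
  exact this.2.continuousWithinAt

theorem IsTimelikeCurve.isCausalCurve {S : Spacetime M} {γ : ℝ → M} {J : Set ℝ}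
    (h : S.IsTimelikeCurve γ J) : S.IsCausalCurve γ J :=
  ⟨h.1, fun t ht => ⟨fun h0 => by simpa [h0] using (h.2 t ht).1, (h.2 t ht).1.le, (h.2 t ht).2⟩⟩

theorem mem_causalFuture_of_mem_chronologicalPast {S : Spacetime M} {p q : M}
    (h : q ∈ S.chronologicalPast p) : p ∈ S.causalFuture q := by
  obtain ⟨γ, hγ, h0, h1⟩ := h
  exact Or.inr ⟨γ, hγ.isCausalCurve, h0, h1⟩

theorem properTime_Icc_lt_top (S : Spacetime M) {γ : ℝ → M} {a b : ℝ} (hab : a < b)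
    (hγ : ContMDiffOn 𝓘(ℝ, ℝ) (𝓡 4) 1 γ (Icc a b)) :
    S.properTime γ (Icc a b) (Icc a b) < ⊤ := by
  have hc := (S.continuousOn_metric_velocity hγ (uniqueDiffOn_Icc hab)).neg.sqrt
  exact (hc.integrableOn_compact isCompact_Icc).lintegral_lt_top

/-- The world line of `O_p` is the timelike curve that witnesses that the start of `γ` precedes `p`;
its proper time is finite by compactness of the parameter interval. -/
theorem IsMalamentHogarth.nonempty_arrangement {S : Spacetime M} (hS : S.IsMalamentHogarth) :
    Nonempty S.Arrangement := by
  obtain ⟨γ, p, hγ, htop, hpast⟩ := hS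
  obtain ⟨γ', hγ', h0, h1⟩ := hpast (mem_image_of_mem γ (mem_Ici.2 le_rfl))
  have hc := (S.continuousOn_metric_velocity hγ.1 (uniqueDiffOn_Ici 0)).neg.sqrt
  choose step hstep₀ hstep using fun s : ℕ => exists_setLIntegral_Icc_eq hc
    (fun t _ => Real.sqrt_nonneg _) htop (c := s * (1 : ℝ)) (by positivity)
  exact ⟨{
    γ₁ := γ, γ₂ := γ', p := p
    γ₁_timelike := hγ
    γ₁_infinite := htop
    γ₁_past := hpast
    γ₂_timelike := hγ'
    γ₂_start := Or.inl h0
    γ₂_end := h1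
    γ₂_finite := S.properTime_Icc_lt_top zero_lt_one hγ'.1
    duration := 1
    duration_pos := one_pos
    step := step
    step_nonneg := hstep₀
    step_time := hstep }⟩

/-- All signals may arrive simultaneously at `p`: a constant `recv` is monotone, so none overtakes
another. -/
theorem Arrangement.receives_iff_sends {S : Spacetime M} (A : S.Arrangement)
    (P : Machine (Option ℕ)) (n : ℕ) (L : List ℕ) : A.Receives P n L ↔ P.Sends n L := by
  refine ⟨And.left, fun h => ⟨h, fun _ => 1, monotoneOn_const, fun s _ => ⟨by simp, ?_⟩⟩⟩
  rw [A.γ₂_end]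
  exact mem_causalFuture_of_mem_chronologicalPast
    (A.γ₁_past (mem_image_of_mem _ (A.step_nonneg s)))

end Spacetime

/-! ### Normal forms for the first two levels of the arithmetical hierarchy -/

theorem isSigma_one_iff {k : ℕ} {P : Set (List.Vector ℕ k)} :
    IsSigma 1 k P ↔ ∃ f : List.Vector ℕ k → ℕ → Bool, Computable₂ f ∧
      ∀ a, a ∈ P ↔ ∃ b, f a b = true := by
  constructor
  · rintro ⟨Q, hQ, rfl⟩
    obtain ⟨f, hf, hQf⟩ := ComputablePred.computable_iff.1 hQ
    have hQ' : ∀ v, v ∈ Q ↔ (!f v) = true := fun v => by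
      have := congrFun hQf v
      simp only [mem_compl_iff, eq_iff_iff] at this
      rw [← not_iff_not, this]; simp
    exact ⟨fun a b => !f (List.Vector.cons b a),
      Primrec.not.to_comp.comp (hf.comp (Computable.vector_cons.comp Computable.snd Computable.fst)),
      fun a => by simp only [mem_ofPred_eq, hQ']⟩
  · rintro ⟨f, hf, hP⟩
    refine ⟨{v | f v.tail v.head = true}, ?_, ?_⟩
    · refine ComputablePred.computable_iff.2 ⟨fun v => !f v.tail v.head,
        Primrec.not.to_comp.comp (hf.comp Computable.vector_tail Computable.vector_head), ?_⟩
      ext v; simp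
    · ext a; simp [hP]

theorem isSigma_two_iff {k : ℕ} {P : Set (List.Vector ℕ k)} :
    IsSigma 2 k P ↔ ∃ f : List.Vector ℕ k → ℕ → ℕ → Bool,
      (Computable fun x : (List.Vector ℕ k × ℕ) × ℕ => f x.1.1 x.1.2 x.2) ∧
      ∀ a, a ∈ P ↔ ∃ b, ∀ c, f a b c = true := by
  constructor
  · rintro ⟨Q, hQ, rfl⟩
    obtain ⟨f, hf, hQf⟩ := isSigma_one_iff.1 hQ
    have hQ' : ∀ v, v ∈ Q ↔ ∀ c, (!f v c) = true := fun v => by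
      rw [← not_iff_not, ← mem_compl_iff, hQf]; simp
    exact ⟨fun a b c => !f (List.Vector.cons b a) c,
      Primrec.not.to_comp.comp (hf.comp (Computable.vector_cons.comp
        (Computable.snd.comp Computable.fst) (Computable.fst.comp Computable.fst)) Computable.snd),
      fun a => by simp only [mem_ofPred_eq, hQ']⟩
  · rintro ⟨f, hf, hP⟩
    refine ⟨{v | ∀ c, f v.tail v.head c = true}, ?_, ?_⟩
    · refine isSigma_one_iff.2 ⟨fun v c => !f v.tail v.head c, Primrec.not.to_comp.comp
        (hf.comp (((Computable.vector_tail.comp Computable.fst).pair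
          (Computable.vector_head.comp Computable.fst)).pair Computable.snd)), fun v => ?_⟩
      simp
    · ext a; simp [hP]

theorem forall_vector_one {p : List.Vector ℕ 1 → Prop} :
    (∀ a, p a) ↔ ∀ n, p (List.Vector.cons n List.Vector.nil) := by
  refine ⟨fun h n => h _, fun h a => ?_⟩
  rw [← List.Vector.cons_head_tail a, show a.tail = List.Vector.nil from Subsingleton.elim
    (α := List.Vector ℕ 0) _ _]
  exact h _

theorem computable_vector_singleton :
    Computable fun n : ℕ => (List.Vector.cons n List.Vector.nil : List.Vector ℕ 1) :=
  Computable.vector_cons.comp Computable.id (Computable.const _)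

theorem mem_sigmaOneSets_iff {R : Set ℕ} :
    R ∈ SigmaOneSets ↔ ∃ f : ℕ → ℕ → Bool, Computable₂ f ∧ ∀ n, n ∈ R ↔ ∃ b, f n b = true := by
  refine isSigma_one_iff.trans ⟨?_, ?_⟩
  · rintro ⟨f, hf, h⟩
    exact ⟨fun n b => f (List.Vector.cons n List.Vector.nil) b,
      hf.comp (computable_vector_singleton.comp Computable.fst) Computable.snd,
      forall_vector_one.1 h⟩
  · rintro ⟨f, hf, h⟩
    exact ⟨fun v b => f v.head b,
      hf.comp (Computable.vector_head.comp Computable.fst) Computable.snd, fun v => h _⟩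

theorem isSigma_two_unary_iff {R : Set ℕ} :
    IsSigma 2 1 (unary R) ↔ ∃ f : ℕ → ℕ → ℕ → Bool,
      (Computable fun x : (ℕ × ℕ) × ℕ => f x.1.1 x.1.2 x.2) ∧
      ∀ n, n ∈ R ↔ ∃ b, ∀ c, f n b c = true := by
  refine isSigma_two_iff.trans ⟨?_, ?_⟩
  · rintro ⟨f, hf, h⟩
    exact ⟨fun n b c => f (List.Vector.cons n List.Vector.nil) b c,
      hf.comp (((computable_vector_singleton.comp (Computable.fst.comp Computable.fst)).pair
        (Computable.snd.comp Computable.fst)).pair Computable.snd),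
      forall_vector_one.1 h⟩
  · rintro ⟨f, hf, h⟩
    exact ⟨fun v b c => f v.head b c,
      hf.comp (((Computable.vector_head.comp (Computable.fst.comp Computable.fst)).pair
        (Computable.snd.comp Computable.fst)).pair Computable.snd), fun v => h _⟩

theorem mem_deltaTwoSets_iff {R : Set ℕ} :
    R ∈ DeltaTwoSets ↔ IsSigma 2 1 (unary R) ∧ IsSigma 2 1 (unary Rᶜ) := Iff.rfl

/-- "Eventually" has the quantifier form `∃ b, ∀ c` over the stages `b + c`. -/
theorem isSigma_two_unary_of_eventually {R : Set ℕ} {g : ℕ → ℕ → Bool} (hg : Computable₂ g)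
    (h : ∀ n, n ∈ R ↔ ∀ᶠ s in atTop, g n s = true) : IsSigma 2 1 (unary R) := by
  refine isSigma_two_unary_iff.2 ⟨fun n b c => g n (b + c),
    hg.comp (Computable.fst.comp Computable.fst) (Primrec.nat_add.to_comp.comp
      (Computable.snd.comp Computable.fst) Computable.snd), fun n => ?_⟩
  rw [h, eventually_atTop]
  exact exists_congr fun a => ⟨fun H c => H _ (Nat.le_add_right _ _), fun H s hs => by
    obtain ⟨c, rfl⟩ := Nat.exists_eq_add_of_le hs; exact H c⟩

/-- A set with a computable approximation that is eventually correct is `Δ₂`. -/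
theorem mem_deltaTwoSets_of_eventually {R : Set ℕ} {g : ℕ → ℕ → Bool} (hg : Computable₂ g)
    (h : ∀ n, ∀ᶠ s in atTop, (g n s = true ↔ n ∈ R)) : R ∈ DeltaTwoSets := by
  refine mem_deltaTwoSets_iff.2 ⟨isSigma_two_unary_of_eventually hg fun n => ?_,
    isSigma_two_unary_of_eventually (g := fun n s => !g n s) (Primrec.not.to_comp.comp hg)
      fun n => ?_⟩
  · rw [← eventually_const (f := atTop (α := ℕ)) (p := n ∈ R)]
    exact eventually_congr ((h n).mono fun s hs => hs.symm)
  · rw [← eventually_const (f := atTop (α := ℕ)) (p := n ∈ Rᶜ)]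
    exact eventually_congr ((h n).mono fun s hs => by simp [← hs])

/-! ### Halting of codes -/

open Nat.Partrec (Code)

namespace Nat.Partrec.Code

/-- The program `c` halts on input `x`. -/
def Halts (c : Code) (x : ℕ) : Prop := (c.eval x).Dom

/-- The program `c` halts on input `x` within the computation bound `s`. -/
def haltsBy (s : ℕ) (c : Code) (x : ℕ) : Bool := (evaln s c x).isSome

theorem haltsBy_mono {s t : ℕ} (h : s ≤ t) {c : Code} {x : ℕ} (hs : haltsBy s c x = true) :
    haltsBy t c x = true := by
  obtain ⟨y, hy⟩ := Option.isSome_iff_exists.1 hs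
  exact Option.isSome_iff_exists.2 ⟨y, evaln_mono h hy⟩

theorem halts_iff {c : Code} {x : ℕ} : c.Halts x ↔ ∃ s, haltsBy s c x = true := by
  simp only [Halts, Part.dom_iff_mem, evaln_complete, haltsBy, Option.isSome_iff_exists]
  exact exists_comm

theorem primrec_haltsBy : Primrec fun a : (ℕ × Code) × ℕ => haltsBy a.1.1 a.1.2 a.2 :=
  _root_.Primrec.option_isSome.comp primrec_evaln

theorem eventually_haltsBy_iff (c : Code) (x : ℕ) :
    ∀ᶠ s in atTop, (haltsBy s c x = true ↔ c.Halts x) := by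
  by_cases h : c.Halts x
  · obtain ⟨s₀, hs₀⟩ := halts_iff.1 h
    filter_upwards [eventually_ge_atTop s₀] with s hs using iff_of_true (haltsBy_mono hs hs₀) h
  · exact Eventually.of_forall fun s => iff_of_false (fun hs => h (halts_iff.2 ⟨s, hs⟩)) h

/-- By unbounded search. Passing from a merely computable `f` to a code makes the test primitive
recursive through `haltsBy`, as the components of a `Machine` must be. -/
theorem exists_halts_iff {α : Type*} [Primcodable α] {f : α → ℕ → Bool} (hf : Computable₂ f) :
    ∃ c : Code, ∀ a, c.Halts (Encodable.encode a) ↔ ∃ b, f a b = true := by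
  have h : _root_.Partrec fun a => Nat.rfind fun b => Part.some (f a b) :=
    _root_.Partrec.rfind hf.partrec₂
  obtain ⟨c, hc⟩ := exists_code.1 h
  refine ⟨c, fun a => ?_⟩
  rw [Halts, hc]
  simp only [Encodable.encodek, Part.coe_some, Part.bind_some, Part.map_Dom]
  refine Nat.rfind_dom'.trans ?_
  simp

theorem setOf_halts_mem_sigmaOneSets (c : Code) {g : ℕ → ℕ} (hg : Primrec g) :
    {n | c.Halts (g n)} ∈ SigmaOneSets :=
  mem_sigmaOneSets_iff.2 ⟨fun n s => haltsBy s c (g n),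
    (primrec_haltsBy.comp ((_root_.Primrec.snd.pair (_root_.Primrec.const c)).pair
      (hg.comp _root_.Primrec.fst))).to_comp, fun _ => halts_iff⟩

end Nat.Partrec.Code

/-- A `Δ₂` set is decided by the parity of any witness for which a certain co-enumerable
condition holds. -/
theorem exists_code_of_mem_deltaTwoSets {R : Set ℕ} (hR : R ∈ DeltaTwoSets) :
    ∃ e : Code, ∀ n, (∃ c, ¬ e.Halts (Nat.pair n c)) ∧
      ∀ c, ¬ e.Halts (Nat.pair n c) → (n ∈ R ↔ c.bodd = false) := by
  obtain ⟨h₁, h₂⟩ := mem_deltaTwoSets_iff.1 hR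
  obtain ⟨f, hf, hfR⟩ := isSigma_two_unary_iff.1 h₁
  obtain ⟨g, hg, hgR⟩ := isSigma_two_unary_iff.1 h₂
  -- The candidate `2a` stands for the witness `a` of `n ∈ R`, and `2a + 1` for the witness `a` of
  -- `n ∉ R`. Halting means that a counterexample `b` exists.
  have hF : Computable₂ fun (x : ℕ × ℕ) (b : ℕ) =>
      bif x.2.bodd then !g x.1 x.2.div2 b else !f x.1 x.2.div2 b := by
    have hx : Computable fun y : (ℕ × ℕ) × ℕ => ((y.1.1, y.1.2.div2), y.2) :=
      (Primrec.pair (Primrec.pair (Primrec.fst.comp Primrec.fst)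
        (Primrec.nat_div2.comp (Primrec.snd.comp Primrec.fst))) Primrec.snd).to_comp
    have hf' : Computable fun y : (ℕ × ℕ) × ℕ => !f y.1.1 y.1.2.div2 y.2 :=
      Primrec.not.to_comp.comp (Computable.comp (g := fun y : (ℕ × ℕ) × ℕ =>
        ((y.1.1, y.1.2.div2), y.2)) hf hx)
    have hg' : Computable fun y : (ℕ × ℕ) × ℕ => !g y.1.1 y.1.2.div2 y.2 :=
      Primrec.not.to_comp.comp (Computable.comp (g := fun y : (ℕ × ℕ) × ℕ =>
        ((y.1.1, y.1.2.div2), y.2)) hg hx)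
    have hb : Computable fun y : (ℕ × ℕ) × ℕ => y.1.2.bodd :=
      (Primrec.nat_bodd.comp (Primrec.snd.comp Primrec.fst)).to_comp
    exact Computable.cond hb hg' hf'
  obtain ⟨e, he⟩ := Nat.Partrec.Code.exists_halts_iff hF
  have he₀ : ∀ n a, ¬ e.Halts (Nat.pair n (Nat.bit false a)) ↔ ∀ b, f n a b = true := fun n a => by
    rw [show Nat.pair n (Nat.bit false a) = Encodable.encode (n, Nat.bit false a) from rfl, he]
    simp
  have he₁ : ∀ n a, ¬ e.Halts (Nat.pair n (Nat.bit true a)) ↔ ∀ b, g n a b = true := fun n a => by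
    rw [show Nat.pair n (Nat.bit true a) = Encodable.encode (n, Nat.bit true a) from rfl, he]
    simp
  refine ⟨e, fun n => ⟨?_, fun c hc => ?_⟩⟩
  · by_cases hn : n ∈ R
    · obtain ⟨a, ha⟩ := (hfR n).1 hn
      exact ⟨_, (he₀ n a).2 ha⟩
    · obtain ⟨a, ha⟩ := (hgR n).1 hn
      exact ⟨_, (he₁ n a).2 ha⟩
  · rw [← Nat.bit_bodd_div2 c] at hc ⊢
    cases hb : c.bodd <;> rw [hb] at hc
    · exact iff_of_true ((hfR n).2 ⟨_, (he₀ _ _).1 hc⟩) (by simp)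
    · exact iff_of_false ((hgR n).2 ⟨_, (he₁ _ _).1 hc⟩) (by simp)

/-! ### Output and signals of machines -/

namespace Machine

variable {σ : Type} [Primcodable σ]

theorem primrec_output (M : Machine σ) : Primrec₂ M.output :=
  M.out_primrec.comp (Primrec.nat_iterate Primrec.snd (M.start_primrec.comp Primrec.fst)
    (M.next_primrec.comp₂ Primrec₂.right))

/-- A machine which shows a given primitive recursive sequence of symbols. -/
def ofPrimrec (f : ℕ → ℕ → σ) (hf : Primrec₂ f) : Machine σ where
  start n := Nat.pair n 0
  next x := Nat.pair x.unpair.1 (x.unpair.2 + 1)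
  out x := f x.unpair.1 x.unpair.2
  start_primrec := Primrec₂.natPair.comp Primrec.id (Primrec.const 0)
  next_primrec := Primrec₂.natPair.comp (Primrec.fst.comp Primrec.unpair)
    (Primrec.succ.comp (Primrec.snd.comp Primrec.unpair))
  out_primrec := hf.comp (Primrec.fst.comp Primrec.unpair) (Primrec.snd.comp Primrec.unpair)

theorem output_ofPrimrec (f : ℕ → ℕ → σ) (hf : Primrec₂ f) (n s : ℕ) :
    (ofPrimrec f hf).output n s = f n s := by
  have h : (ofPrimrec f hf).next^[s] ((ofPrimrec f hf).start n) = Nat.pair n s := by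
    induction s with
    | zero => rfl
    | succ s ih => rw [Function.iterate_succ_apply', ih]; simp [ofPrimrec]
  rw [output, h]
  simp [ofPrimrec]

theorem primrec_log (P : Machine (Option ℕ)) : Primrec₂ P.log :=
  Primrec.listFilterMap (Primrec.list_range.comp Primrec.snd)
    (P.primrec_output.comp₂ (Primrec.fst.comp₂ Primrec₂.left) Primrec₂.right)

theorem log_succ (P : Machine (Option ℕ)) (n s : ℕ) :
    P.log n (s + 1) = P.log n s ++ (P.output n s).toList := by
  rw [log, List.range_succ, List.filterMap_append, ← log]
  cases h : P.output n s <;> simp [h]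

theorem log_prefix (P : Machine (Option ℕ)) (n : ℕ) {s t : ℕ} (h : s ≤ t) :
    P.log n s <+: P.log n t := by
  induction h with
  | refl => exact List.prefix_rfl
  | step _ ih => exact ih.trans (by rw [Nat.succ_eq_add_one, log_succ]; exact List.prefix_append _ _)

theorem Sends.prefix {P : Machine (Option ℕ)} {n : ℕ} {L : List ℕ} (h : P.Sends n L) (s : ℕ) :
    P.log n s <+: L := by
  obtain ⟨s₀, hs₀⟩ := h
  rw [← hs₀ _ (le_max_left s₀ s)]
  exact P.log_prefix n (le_max_right s₀ s)

theorem sends_iff_eventually {P : Machine (Option ℕ)} {n : ℕ} {L : List ℕ} :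
    P.Sends n L ↔ ∀ᶠ s in atTop, P.log n s = L := eventually_atTop.symm

theorem Sends.exists_output_eq_none {P : Machine (Option ℕ)} {n : ℕ} {L : List ℕ}
    (h : P.Sends n L) : ∃ s₀, ∀ s, s₀ ≤ s → P.output n s = none := by
  obtain ⟨s₀, hs₀⟩ := h
  refine ⟨s₀, fun s hs => ?_⟩
  have := P.log_succ n s
  rw [hs₀ s hs, hs₀ (s + 1) (by omega)] at this
  cases h : P.output n s with
  | none => rfl
  | some m => simp [h] at this

theorem sends_of_output_eq_none {P : Machine (Option ℕ)} {n s₀ : ℕ}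
    (h : ∀ s, s₀ ≤ s → P.output n s = none) : P.Sends n (P.log n s₀) := by
  refine ⟨s₀, fun s hs => ?_⟩
  induction s, hs using Nat.le_induction with
  | base => rfl
  | succ s hs ih => rw [log_succ, ih, h s hs]; simp

end Machine

/-! ### Elimination of the spacetime, and the upper bound `Δ₂` -/

/-- The sets decidable by a machine that sends finitely many and at most `B` signals on every
input, with the answer computed from the input and the messages. -/
def signalDecidableSets (B : ℕ∞) : Set (Set ℕ) :=
  {R | ∃ (P : Machine (Option ℕ)) (D : ℕ → List ℕ → Bool), Computable₂ D ∧
    ∀ n, ∃ L, P.Sends n L ∧ (L.length : ℕ∞) ≤ B ∧ (n ∈ R ↔ D n L = true)}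

theorem Spacetime.IsMalamentHogarth.decidableSets_eq {M : Type*} [TopologicalSpace M]
    [ChartedSpace (EuclideanSpace ℝ (Fin 4)) M] [IsManifold (𝓡 4) ∞ M] {S : Spacetime M}
    (hS : S.IsMalamentHogarth) (B : ℕ∞) : S.decidableSets B = signalDecidableSets B := by
  ext R
  constructor
  · rintro ⟨A, P, D, hD, h⟩
    refine ⟨P, D, hD, fun n => ?_⟩
    obtain ⟨L, hL, h⟩ := h n
    exact ⟨L, hL.1, h⟩
  · rintro ⟨P, D, hD, h⟩
    obtain ⟨A⟩ := hS.nonempty_arrangement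
    refine ⟨A, P, D, hD, fun n => ?_⟩
    obtain ⟨L, hL, h⟩ := h n
    exact ⟨L, (A.receives_iff_sends P n L).2 hL, h⟩

/-- The receiver's answer on the partial log is correct as soon as the log is complete. -/
theorem signalDecidableSets_subset_deltaTwoSets (B : ℕ∞) :
    signalDecidableSets B ⊆ DeltaTwoSets := by
  rintro R ⟨P, D, hD, h⟩
  refine mem_deltaTwoSets_of_eventually (g := fun n s => D n (P.log n s))
    (hD.comp Computable.fst P.primrec_log.to_comp) fun n => ?_
  obtain ⟨L, hL, -, hR⟩ := h n
  filter_upwards [Machine.sends_iff_eventually.1 hL] with s hs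
  rw [hs, hR]

theorem mem_deltaTwoSets_of_isTrialAndError {R : Set ℕ} (h : IsTrialAndError R) :
    R ∈ DeltaTwoSets := by
  obtain ⟨M₀, M₁, -, -, h⟩ := h
  have hc : ∀ (N : Machine (Option Bool)) (v : Option Bool),
      Computable fun x : ℕ × ℕ => N.output x.1 x.2 == v := fun N v =>
    Primrec.to_comp ((Primrec.beq.comp N.primrec_output (Primrec.const v)).of_eq
      fun x => by rw [Bool.eq_iff_iff]; simp)
  refine mem_deltaTwoSets_iff.2
    ⟨isSigma_two_unary_of_eventually (g := fun n s => M₀.output n s == some true)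
      (hc M₀ (some true)) fun n => ?_,
      isSigma_two_unary_of_eventually (g := fun n s => M₁.output n s == some false)
        (hc M₁ (some false)) fun n => ?_⟩
  · simpa [Machine.EventualValue] using (h n).1
  · simpa [Machine.EventualValue] using (h n).2

/-! ### Search for a witness, with a signal at each failure -/

/-- The state of the search for a number `c` such that `e` does not halt on `(n, c)`: the present
candidate and the bound up to which it has been tested. -/
def searchState (e : Code) (n : ℕ) : ℕ → ℕ × ℕ
  | 0 => (0, 0)
  | s + 1 => bif Code.haltsBy (searchState e n s).2 e (Nat.pair n (searchState e n s).1)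
      then ((searchState e n s).1 + 1, 0)
      else ((searchState e n s).1, (searchState e n s).2 + 1)

theorem primrec_searchState (e : Code) : Primrec₂ (searchState e) := by
  have htest : Primrec fun x : ℕ × ℕ × ℕ × ℕ =>
      Code.haltsBy x.2.2.2 e (Nat.pair x.1 x.2.2.1) :=
    Code.primrec_haltsBy.comp (((Primrec.snd.comp (Primrec.snd.comp Primrec.snd)).pair
      (Primrec.const e)).pair (Primrec₂.natPair.comp Primrec.fst
        (Primrec.fst.comp (Primrec.snd.comp Primrec.snd))))
  have hstep : Primrec₂ fun (n : ℕ) (x : ℕ × ℕ × ℕ) =>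
      bif Code.haltsBy x.2.2 e (Nat.pair n x.2.1) then (x.2.1 + 1, 0) else (x.2.1, x.2.2 + 1) :=
    Primrec.cond htest
      ((Primrec.succ.comp (Primrec.fst.comp (Primrec.snd.comp Primrec.snd))).pair
        (Primrec.const 0))
      ((Primrec.fst.comp (Primrec.snd.comp Primrec.snd)).pair
        (Primrec.succ.comp (Primrec.snd.comp (Primrec.snd.comp Primrec.snd))))
  refine (Primrec.nat_rec (f := fun _ : ℕ => ((0 : ℕ), (0 : ℕ))) (Primrec.const _) hstep).of_eq
    fun n s => ?_
  induction s with
  | zero => rfl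
  | succ s ih => simp only [searchState] at ih ⊢; rw [← ih]

/-- The candidate never decreases and cannot pass `c₀`, on which no test succeeds, so it becomes
constant. -/
theorem exists_searchState_eq {e : Code} {n c₀ : ℕ} (h : ¬ e.Halts (Nat.pair n c₀)) :
    ∃ c s₀, (∀ s, s₀ ≤ s → (searchState e n s).1 = c ∧
      Code.haltsBy (searchState e n s).2 e (Nat.pair n c) = false) ∧
      ¬ e.Halts (Nat.pair n c) := by
  have hle : ∀ s, (searchState e n s).1 ≤ c₀ := by
    intro s
    induction s with
    | zero => simp [searchState]
    | succ s ih =>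
      rw [searchState]
      cases hb : Code.haltsBy (searchState e n s).2 e (Nat.pair n (searchState e n s).1) with
      | false => simpa using ih
      | true =>
        have : (searchState e n s).1 ≠ c₀ := fun heq =>
          h (Code.halts_iff.2 ⟨_, heq ▸ hb⟩)
        simp only [cond_true]
        omega
  have hmono : Monotone fun s => (searchState e n s).1 := by
    refine monotone_nat_of_le_succ fun s => ?_
    rw [searchState]
    cases Code.haltsBy (searchState e n s).2 e (Nat.pair n (searchState e n s).1) <;> simp
  obtain ⟨s₀, hs₀⟩ : ∃ s₀, ∀ s, s₀ ≤ s → (searchState e n s).1 = (searchState e n s₀).1 := by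
    have hfin : (range fun s => (searchState e n s).1).Finite :=
      (finite_Iic c₀).subset (range_subset_iff.2 hle)
    obtain ⟨-, ⟨s₀, rfl⟩, hmax⟩ := hfin.exists_maximal (range_nonempty _)
    exact ⟨s₀, fun s hs => le_antisymm (hmax ⟨s, rfl⟩ (hmono hs)) (hmono hs)⟩
  have htest : ∀ s, s₀ ≤ s → Code.haltsBy (searchState e n s).2 e
      (Nat.pair n (searchState e n s₀).1) = false := by
    intro s hs
    refine Bool.eq_false_iff.2 fun hb => ?_
    have h1 := hs₀ (s + 1) (by omega)
    rw [searchState, hs₀ s hs, hb] at h1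
    simp at h1
  refine ⟨_, s₀, fun s hs => ⟨hs₀ s hs, htest s hs⟩, fun hh => ?_⟩
  -- With the candidate fixed, the test bound grows by one per step, so halting on the final
  -- candidate would be detected.
  have hlarge : ∀ t, t ≤ (searchState e n (s₀ + t)).2 := by
    intro t
    induction t with
    | zero => exact Nat.zero_le _
    | succ t ih =>
      rw [← add_assoc, searchState, hs₀ (s₀ + t) (by omega), htest (s₀ + t) (by omega)]
      simpa using ih
  obtain ⟨t, ht⟩ := Code.halts_iff.1 hh
  have := Code.haltsBy_mono (hlarge t) ht
  rw [htest (s₀ + t) (by omega)] at this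
  cases this

theorem deltaTwoSets_subset_signalDecidableSets_top :
    DeltaTwoSets ⊆ signalDecidableSets ⊤ := by
  intro R hR
  obtain ⟨e, he⟩ := exists_code_of_mem_deltaTwoSets hR
  have hf : Primrec₂ fun n s : ℕ => bif Code.haltsBy (searchState e n s).2 e
      (Nat.pair n (searchState e n s).1) then some 0 else (none : Option ℕ) :=
    Primrec.cond (Code.primrec_haltsBy.comp
      (((Primrec.snd.comp (primrec_searchState e)).pair (Primrec.const e)).pair
        (Primrec₂.natPair.comp Primrec.fst (Primrec.fst.comp (primrec_searchState e)))))
      (Primrec.const _) (Primrec.const _)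
  set P := Machine.ofPrimrec _ hf with hP
  have hout : ∀ n s, P.output n s = bif Code.haltsBy (searchState e n s).2 e
      (Nat.pair n (searchState e n s).1) then some 0 else none := Machine.output_ofPrimrec _ hf
  -- One signal per rejection: the number of messages is the current candidate, and their content is
  -- irrelevant.
  have hlen : ∀ n s, (P.log n s).length = (searchState e n s).1 := by
    intro n s
    induction s with
    | zero => rfl
    | succ s ih =>
      rw [Machine.log_succ, List.length_append, ih, hout, searchState]
      cases Code.haltsBy (searchState e n s).2 e (Nat.pair n (searchState e n s).1) <;> simp
  refine ⟨P, fun _ L => !L.length.bodd, (Primrec.not.comp (Primrec.nat_bodd.comp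
    (Primrec.list_length.comp Primrec.snd))).to_comp, fun n => ?_⟩
  obtain ⟨⟨c₀, hc₀⟩, hn⟩ := he n
  obtain ⟨c, s₀, hs₀, hc⟩ := exists_searchState_eq hc₀
  refine ⟨P.log n s₀, Machine.sends_of_output_eq_none fun s hs => ?_, le_top, ?_⟩
  · rw [hout, (hs₀ s hs).1, (hs₀ s hs).2]; rfl
  · simp only [hlen, (hs₀ s₀ le_rfl).1, hn c hc, Bool.not_eq_true']

/-- A single machine serves as both `M₀` and `M₁`, since its output always settles on a digit. -/
theorem isTrialAndError_of_mem_deltaTwoSets {R : Set ℕ} (hR : R ∈ DeltaTwoSets) :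
    IsTrialAndError R := by
  obtain ⟨e, he⟩ := exists_code_of_mem_deltaTwoSets hR
  have hf : Primrec₂ fun n s : ℕ => some (!(searchState e n s).1.bodd) :=
    Primrec.option_some.comp (Primrec.not.comp (Primrec.nat_bodd.comp
      (Primrec.fst.comp (primrec_searchState e))))
  set N := Machine.ofPrimrec _ hf with hN
  have key : ∀ n, ∃ v, N.EventualValue n (some v) ∧ (n ∈ R ↔ v = true) := by
    intro n
    obtain ⟨⟨c₀, hc₀⟩, hn⟩ := he n
    obtain ⟨c, s₀, hs₀, hc⟩ := exists_searchState_eq hc₀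
    refine ⟨!c.bodd, eventually_atTop.2 ⟨s₀, fun s hs => ?_⟩, by rw [hn c hc]; simp⟩
    rw [hN, Machine.output_ofPrimrec, (hs₀ s hs).1]
  have hiff : ∀ n u v, N.EventualValue n (some v) → (N.EventualValue n (some u) ↔ v = u) :=
    fun n u v hv => ⟨fun hu => by
      obtain ⟨s, h1, h2⟩ := (hv.and hu).exists
      simpa [h1] using h2, fun h => h ▸ hv⟩
  have hfin : N.FinitelyManyChanges := by
    intro n
    obtain ⟨v, hv, -⟩ := key n
    obtain ⟨s₀, hs₀⟩ := eventually_atTop.1 hv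
    refine (finite_Iio s₀).subset fun s hs => ?_
    by_contra hlt
    rw [mem_Iio, not_lt] at hlt
    exact hs ((hs₀ (s + 1) (by omega)).trans (hs₀ s hlt).symm)
  refine ⟨N, N, hfin, hfin, fun n => ?_⟩
  obtain ⟨v, hv, hR⟩ := key n
  rw [hiff n _ v hv, hiff n _ v hv, hR]
  simp

/-! ### Boundedly many signals -/

/-- Here `i` is a guess at the total number of messages. The code `a` looks for a stage with exactly
`i` messages and a positive answer, `e` for a stage with `i + 1` messages; together they confirm the
guess and the answer. -/
theorem exists_codes_of_mem_signalDecidableSets {R : Set ℕ} {k : ℕ}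
    (hR : R ∈ signalDecidableSets k) :
    ∃ a e : Code, ∀ n, n ∈ R ↔
      ∃ i < k + 1, a.Halts (Nat.pair n i) ∧ ¬ e.Halts (Nat.pair n i) := by
  obtain ⟨P, D, hD, h⟩ := hR
  have hlog : Computable fun x : (ℕ × ℕ) × ℕ => P.log x.1.1 x.2 :=
    (P.primrec_log.comp (Primrec.fst.comp Primrec.fst) Primrec.snd).to_comp
  have hlen : Computable fun x : (ℕ × ℕ) × ℕ => (P.log x.1.1 x.2).length :=
    Primrec.list_length.to_comp.comp hlog
  have hind : Computable fun x : (ℕ × ℕ) × ℕ => x.1.2 := Computable.snd.comp Computable.fst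
  have ha : Computable₂ fun (x : ℕ × ℕ) (s : ℕ) =>
      (P.log x.1 s).length == x.2 && D x.1 (P.log x.1 s) :=
    Primrec.and.to_comp.comp (Primrec.beq.to_comp.comp hlen hind)
      (hD.comp (Computable.fst.comp Computable.fst) hlog)
  have he : Computable₂ fun (x : ℕ × ℕ) (s : ℕ) => (P.log x.1 s).length == x.2 + 1 :=
    Primrec.beq.to_comp.comp hlen (Computable.succ.comp hind)
  obtain ⟨a, ha⟩ := Code.exists_halts_iff ha
  obtain ⟨e, he⟩ := Code.exists_halts_iff he
  have ha' : ∀ n i, a.Halts (Nat.pair n i) ↔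
      ∃ s, (P.log n s).length = i ∧ D n (P.log n s) = true := fun n i => by
    rw [show Nat.pair n i = Encodable.encode (n, i) from rfl, ha]; simp
  have he' : ∀ n i, e.Halts (Nat.pair n i) ↔ ∃ s, (P.log n s).length = i + 1 := fun n i => by
    rw [show Nat.pair n i = Encodable.encode (n, i) from rfl, he]; simp
  refine ⟨a, e, fun n => ?_⟩
  obtain ⟨L, hL, hk, hR⟩ := h n
  have hk' : L.length ≤ k := by exact_mod_cast hk
  simp only [ha', he']
  constructor
  · intro hn
    obtain ⟨s₀, hs₀⟩ := hL
    refine ⟨L.length, by omega, ⟨s₀, by rw [hs₀ s₀ le_rfl], by rw [hs₀ s₀ le_rfl]; exact hR.1 hn⟩,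
      ?_⟩
    rintro ⟨s, hs⟩
    have := (Machine.Sends.prefix ⟨s₀, hs₀⟩ s : P.log n s <+: L).length_le
    omega
  · rintro ⟨i, -, ⟨s, hs, hD⟩, hnot⟩
    -- A log grows by at most one message per step, so it cannot exceed length `i` without passing
    -- through `i + 1`.
    have hgrow : ∀ t, s ≤ t → (P.log n t).length = i := by
      intro t ht
      induction t, ht using Nat.le_induction with
      | base => exact hs
      | succ t _ ih =>
        by_contra hne
        refine hnot ⟨t + 1, ?_⟩
        have hl := P.log_succ n t
        cases hv : P.output n t with
        | none => rw [hv] at hl; simp [hl, ih] at hne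
        | some m => rw [hv] at hl; simp [hl, ih]
    obtain ⟨s₀, hs₀⟩ := hL
    have h1 := hs₀ (max s₀ s) (le_max_left _ _)
    have h2 := hgrow (max s₀ s) (le_max_right _ _)
    have h3 := (P.log_prefix n (le_max_right s₀ s)).eq_of_length (by rw [hs, h2])
    rw [hR, ← h1, ← h3]
    exact hD

theorem mem_closure_sigmaOneSets_of_mem_signalDecidableSets {R : Set ℕ} {k : ℕ}
    (hR : R ∈ signalDecidableSets k) : R ∈ BooleanSubalgebra.closure SigmaOneSets := by
  obtain ⟨a, e, h⟩ := exists_codes_of_mem_signalDecidableSets hR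
  have hmem : ∀ (c : Code) (i : ℕ), {n | c.Halts (Nat.pair n i)} ∈
      BooleanSubalgebra.closure SigmaOneSets := fun c i =>
    BooleanSubalgebra.subset_closure (Code.setOf_halts_mem_sigmaOneSets c
      (Primrec₂.natPair.comp Primrec.id (Primrec.const i)))
  have key : ∀ m, {n | ∃ i < m, a.Halts (Nat.pair n i) ∧ ¬ e.Halts (Nat.pair n i)} ∈
      BooleanSubalgebra.closure SigmaOneSets := by
    intro m
    induction m with
    | zero =>
      convert! (BooleanSubalgebra.closure SigmaOneSets).bot_mem using 1
      ext; simp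
    | succ m ih =>
      convert! BooleanSubalgebra.sup_mem ih (BooleanSubalgebra.sdiff_mem (hmem a m) (hmem e m))
        using 1
      ext n
      exact Nat.exists_lt_succ_right
  rw [show R = _ from Set.ext h]
  exact key _

theorem compl_mem_signalDecidableSets {B : ℕ∞} {R : Set ℕ} (h : R ∈ signalDecidableSets B) :
    Rᶜ ∈ signalDecidableSets B := by
  obtain ⟨P, D, hD, h⟩ := h
  refine ⟨P, fun n L => !D n L, Primrec.not.to_comp.comp hD, fun n => ?_⟩
  obtain ⟨L, hL, hB, hR⟩ := h n
  exact ⟨L, hL, hB, by rw [mem_compl_iff, hR]; simp⟩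

theorem empty_mem_signalDecidableSets (B : ℕ∞) : ∅ ∈ signalDecidableSets B :=
  ⟨Machine.ofPrimrec (fun _ _ => none) (Primrec.const none), fun _ _ => false, Computable.const _,
    fun n => ⟨_, Machine.sends_of_output_eq_none (s₀ := 0)
      fun s _ => Machine.output_ofPrimrec _ _ n s, by simp [Machine.log], by simp⟩⟩

/-- The only signal is sent at the step where `haltsBy` turns from false to true; by monotonicity
this happens at most once. -/
theorem mem_signalDecidableSets_one_of_mem_sigmaOneSets {R : Set ℕ} (hR : R ∈ SigmaOneSets) :
    R ∈ signalDecidableSets (1 : ℕ) := by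
  obtain ⟨f, hf, h⟩ := mem_sigmaOneSets_iff.1 hR
  obtain ⟨c, hc⟩ := Code.exists_halts_iff hf
  have hc' : ∀ n, n ∈ R ↔ c.Halts n := fun n => (h n).trans (hc n).symm
  have hb : Primrec₂ fun n s : ℕ => Code.haltsBy s c n :=
    Code.primrec_haltsBy.comp ((Primrec.snd.pair (Primrec.const c)).pair Primrec.fst)
  have hp : Primrec₂ fun n s : ℕ =>
      bif !Code.haltsBy s c n && Code.haltsBy (s + 1) c n then some 0 else (none : Option ℕ) :=
    Primrec.cond (Primrec.and.comp (Primrec.not.comp hb)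
      (hb.comp Primrec.fst (Primrec.succ.comp Primrec.snd))) (Primrec.const _) (Primrec.const _)
  set P := Machine.ofPrimrec _ hp with hP
  have hout : ∀ n s, P.output n s =
      bif !Code.haltsBy s c n && Code.haltsBy (s + 1) c n then some 0 else none :=
    Machine.output_ofPrimrec _ hp
  have hlog : ∀ n s, P.log n s = bif Code.haltsBy s c n then [0] else [] := by
    intro n s
    induction s with
    | zero => simp [Machine.log, Code.haltsBy, Code.evaln]
    | succ s ih =>
      rw [Machine.log_succ, ih, hout]
      cases h1 : Code.haltsBy s c n with
      | true => simp [Code.haltsBy_mono s.le_succ h1]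
      | false => cases Code.haltsBy (s + 1) c n <;> simp
  refine ⟨P, fun _ L => L.length == 1, Computable.comp Primrec.beq.to_comp
    ((Primrec.list_length.comp Primrec.snd).pair (Primrec.const 1)).to_comp, fun n => ?_⟩
  classical
  refine ⟨if c.Halts n then [0] else [], Machine.sends_iff_eventually.2 ?_, ?_, ?_⟩
  · filter_upwards [Code.eventually_haltsBy_iff c n] with s hs
    rw [hlog, ← Bool.cond_decide]
    congr 1
    rw [Bool.eq_iff_iff, hs, decide_eq_true_iff]
  · split_ifs <;> simp
  · rw [hc']
    split_ifs with hn <;> simp [hn]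

/-- Both machines run in lockstep. A signal is sent when at least one of them sends, and its message
encodes both outputs, so the receiver recovers both logs. -/
theorem union_mem_signalDecidableSets {B C : ℕ∞} {R T : Set ℕ} (hR : R ∈ signalDecidableSets B)
    (hT : T ∈ signalDecidableSets C) : R ∪ T ∈ signalDecidableSets (B + C) := by
  obtain ⟨P, D, hD, hR⟩ := hR
  obtain ⟨Q, E, hE, hT⟩ := hT
  have hpair : Primrec₂ fun n s => (P.output n s, Q.output n s) :=
    Primrec.pair P.primrec_output Q.primrec_output
  have hf : Primrec₂ fun n s => if (P.output n s, Q.output n s) = (none, none) then none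
      else some (Encodable.encode (P.output n s, Q.output n s)) :=
    Primrec.ite (Primrec.eq.comp hpair (Primrec.const (none, none))) (Primrec.const _)
      (Primrec.option_some.comp (Primrec.encode.comp hpair))
  set N := Machine.ofPrimrec _ hf with hN
  have hout : ∀ n s, N.output n s = if (P.output n s, Q.output n s) = (none, none) then none
      else some (Encodable.encode (P.output n s, Q.output n s)) := Machine.output_ofPrimrec _ hf
  let p₁ : ℕ → Option ℕ := fun m => (Denumerable.ofNat (Option ℕ × Option ℕ) m).1
  let p₂ : ℕ → Option ℕ := fun m => (Denumerable.ofNat (Option ℕ × Option ℕ) m).2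
  have hp₁ : Primrec p₁ := Primrec.fst.comp (Primrec.ofNat _)
  have hp₂ : Primrec p₂ := Primrec.snd.comp (Primrec.ofNat _)
  have hlog₁ : ∀ n s, (N.log n s).filterMap p₁ = P.log n s := by
    intro n s
    rw [Machine.log, List.filterMap_filterMap]
    refine congrArg (fun f => List.filterMap f _) (funext fun t => ?_)
    rw [hout]
    split_ifs with h
    · exact (congrArg Prod.fst h).symm
    · simp only [Option.bind_some, p₁, Denumerable.ofNat_encode]
  have hlog₂ : ∀ n s, (N.log n s).filterMap p₂ = Q.log n s := by
    intro n s
    rw [Machine.log, List.filterMap_filterMap]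
    refine congrArg (fun f => List.filterMap f _) (funext fun t => ?_)
    rw [hout]
    split_ifs with h
    · exact (congrArg Prod.snd h).symm
    · simp only [Option.bind_some, p₂, Denumerable.ofNat_encode]
  have hlen : ∀ n s, (N.log n s).length ≤ (P.log n s).length + (Q.log n s).length := by
    intro n s
    induction s with
    | zero => simp [Machine.log]
    | succ s ih =>
      rw [Machine.log_succ, Machine.log_succ, Machine.log_succ, hout]
      cases P.output n s <;> cases Q.output n s <;> simp <;> omega
  have hfil : ∀ p : ℕ → Option ℕ, Primrec p →
      Computable fun x : ℕ × List ℕ => x.2.filterMap p := fun p hp =>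
    (Primrec.listFilterMap Primrec.snd (hp.comp₂ Primrec₂.right)).to_comp
  refine ⟨N, fun n L => D n (L.filterMap p₁) || E n (L.filterMap p₂),
    Primrec.or.to_comp.comp (hD.comp Computable.fst (hfil p₁ hp₁))
      (hE.comp Computable.fst (hfil p₂ hp₂)), fun n => ?_⟩
  obtain ⟨L₁, hL₁, hB, hR⟩ := hR n
  obtain ⟨L₂, hL₂, hC, hT⟩ := hT n
  obtain ⟨s₁, hs₁⟩ := hL₁.exists_output_eq_none
  obtain ⟨s₂, hs₂⟩ := hL₂.exists_output_eq_none
  -- A common stage at which both logs are complete and after which both machines are silent.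
  obtain ⟨s, h₁, h₂, hs₁', hs₂'⟩ := ((Machine.sends_iff_eventually.1 hL₁).and
    ((Machine.sends_iff_eventually.1 hL₂).and
      ((eventually_ge_atTop s₁).and (eventually_ge_atTop s₂)))).exists
  refine ⟨N.log n s, Machine.sends_of_output_eq_none fun t ht => ?_, ?_, ?_⟩
  · rw [hout, hs₁ t (hs₁'.trans ht), hs₂ t (hs₂'.trans ht)]; simp
  · refine le_trans ?_ (add_le_add hB hC)
    rw [← h₁, ← h₂]
    exact_mod_cast hlen n s
  · simp only [hlog₁, hlog₂, h₁, h₂, mem_union, hR, hT, Bool.or_eq_true]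

theorem iUnion_signalDecidableSets :
    (⋃ k : ℕ, signalDecidableSets (k : ℕ∞)) =
      (BooleanSubalgebra.closure SigmaOneSets : Set (Set ℕ)) := by
  refine Subset.antisymm (iUnion_subset fun k R hR =>
    mem_closure_sigmaOneSets_of_mem_signalDecidableSets hR) fun R hR => ?_
  rw [SetLike.mem_coe] at hR
  induction hR using BooleanSubalgebra.closure_bot_sup_induction with
  | mem R hR => exact mem_iUnion.2 ⟨1, mem_signalDecidableSets_one_of_mem_sigmaOneSets hR⟩
  | bot => exact mem_iUnion.2 ⟨0, empty_mem_signalDecidableSets _⟩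
  | sup R _ T _ hR hT =>
    obtain ⟨k, hk⟩ := mem_iUnion.1 hR
    obtain ⟨l, hl⟩ := mem_iUnion.1 hT
    exact mem_iUnion.2 ⟨k + l, by exact_mod_cast union_mem_signalDecidableSets hk hl⟩
  | compl R _ hR =>
    obtain ⟨k, hk⟩ := mem_iUnion.1 hR
    exact mem_iUnion.2 ⟨k, compl_mem_signalDecidableSets hk⟩

/-! ### A `Δ₂` set not decidable with boundedly many signals -/

/-- Whether `a` but not `e` halts within the bound `s` on `(n, i)` for some `i < k`. -/
def someDifferenceBy (s : ℕ) (a e : Code) (n : ℕ) : ℕ → Bool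
  | 0 => false
  | k + 1 => someDifferenceBy s a e n k ||
      (Code.haltsBy s a (Nat.pair n k) && !Code.haltsBy s e (Nat.pair n k))

/-- Only finitely many halting questions are involved, and the approximation to each one stabilises.
-/
theorem eventually_someDifferenceBy_iff (a e : Code) (n k : ℕ) :
    ∀ᶠ s in atTop, (someDifferenceBy s a e n k = true ↔
      ∃ i < k, a.Halts (Nat.pair n i) ∧ ¬ e.Halts (Nat.pair n i)) := by
  induction k with
  | zero => simp [someDifferenceBy]
  | succ k ih =>
    filter_upwards [ih, Code.eventually_haltsBy_iff a (Nat.pair n k),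
      Code.eventually_haltsBy_iff e (Nat.pair n k)] with s h1 h2 h3
    rw [someDifferenceBy, Bool.or_eq_true, Bool.and_eq_true, h1, h2, Bool.not_eq_true',
      ← Bool.not_eq_true, h3]
    exact Nat.exists_lt_succ_right.symm

/-- Uniformity in `k`, `a` and `e` is essential: the diagonal set reads all three off its argument.
-/
theorem primrec_someDifferenceBy : Primrec fun x : ((ℕ × Code × Code) × ℕ) × ℕ =>
    someDifferenceBy x.2 x.1.1.2.1 x.1.1.2.2 x.1.2 x.1.1.1 := by
  have hh : ∀ c : ℕ × Code × Code → Code, Primrec c →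
      Primrec₂ fun (x : ((ℕ × Code × Code) × ℕ) × ℕ) (y : ℕ × Bool) =>
        Code.haltsBy x.2 (c x.1.1) (Nat.pair x.1.2 y.1) := by
    intro c hc
    have hx : Primrec fun z : (((ℕ × Code × Code) × ℕ) × ℕ) × ℕ × Bool =>
        ((z.1.2, c z.1.1.1), Nat.pair z.1.1.2 z.2.1) :=
      ((Primrec.snd.comp Primrec.fst).pair
        (hc.comp (Primrec.fst.comp (Primrec.fst.comp Primrec.fst)))).pair
        (Primrec₂.natPair.comp (Primrec.snd.comp (Primrec.fst.comp Primrec.fst))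
          (Primrec.fst.comp Primrec.snd))
    have h := Primrec.comp Code.primrec_haltsBy hx
    exact h
  have ha := hh (fun y => y.2.1) (Primrec.fst.comp Primrec.snd)
  have he := hh (fun y => y.2.2) (Primrec.snd.comp Primrec.snd)
  have hstep : Primrec₂ fun (x : ((ℕ × Code × Code) × ℕ) × ℕ) (y : ℕ × Bool) =>
      y.2 || (Code.haltsBy x.2 x.1.1.2.1 (Nat.pair x.1.2 y.1) &&
        !Code.haltsBy x.2 x.1.1.2.2 (Nat.pair x.1.2 y.1)) :=
    Primrec.or.comp₂ (Primrec.snd.comp₂ Primrec₂.right)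
      (Primrec.and.comp₂ ha (Primrec.not.comp₂ he))
  have hk : Primrec fun x : ((ℕ × Code × Code) × ℕ) × ℕ => x.1.1.1 :=
    Primrec.fst.comp (Primrec.fst.comp Primrec.fst)
  refine (Primrec.nat_rec' hk (Primrec.const false) hstep).of_eq fun x => ?_
  obtain ⟨⟨⟨k, a, e⟩, n⟩, s⟩ := x
  induction k with
  | zero => rfl
  | succ k ih => simp only [someDifferenceBy] at ih ⊢; rw [← ih]

/-- The diagonal set: `n` is a member unless it belongs to the finite union of differences of
enumerable sets that is coded by `n` itself. -/
def diagonalSet : Set ℕ :=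
  {n | ¬ ∃ i < (Denumerable.ofNat (ℕ × Code × Code) n).1,
    (Denumerable.ofNat (ℕ × Code × Code) n).2.1.Halts (Nat.pair n i) ∧
    ¬ (Denumerable.ofNat (ℕ × Code × Code) n).2.2.Halts (Nat.pair n i)}

theorem diagonalSet_mem_deltaTwoSets : diagonalSet ∈ DeltaTwoSets := by
  refine mem_deltaTwoSets_of_eventually (g := fun n s =>
    !someDifferenceBy s (Denumerable.ofNat (ℕ × Code × Code) n).2.1
      (Denumerable.ofNat (ℕ × Code × Code) n).2.2 n (Denumerable.ofNat (ℕ × Code × Code) n).1)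
    (Primrec.not.comp (primrec_someDifferenceBy.comp ((((Primrec.ofNat _).comp
      Primrec.fst).pair Primrec.fst).pair Primrec.snd))).to_comp fun n => ?_
  filter_upwards [eventually_someDifferenceBy_iff (Denumerable.ofNat (ℕ × Code × Code) n).2.1
    (Denumerable.ofNat (ℕ × Code × Code) n).2.2 n (Denumerable.ofNat (ℕ × Code × Code) n).1]
    with s hs
  rw [Bool.not_eq_true', ← Bool.not_eq_true, hs]
  rfl

theorem diagonalSet_notMem_signalDecidableSets (k : ℕ) : diagonalSet ∉ signalDecidableSets k := by
  intro h
  obtain ⟨a, e, hae⟩ := exists_codes_of_mem_signalDecidableSets h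
  -- The set is evaluated at its own code; the range is `k + 1` because `k` signals allow the counts
  -- `0, …, k`.
  have := hae (Encodable.encode (k + 1, a, e))
  simp only [diagonalSet, mem_ofPred_eq, Denumerable.ofNat_encode] at this
  exact iff_not_self this.symm

/-! ### Comparison of the signal classes with `Δ₂` -/

theorem signalDecidableSets_top : signalDecidableSets ⊤ = DeltaTwoSets :=
  (signalDecidableSets_subset_deltaTwoSets ⊤).antisymm
    deltaTwoSets_subset_signalDecidableSets_top

/-- The same diagonal set escapes every bound `k`, so it escapes their union too. -/
theorem iUnion_signalDecidableSets_ssubset :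
    (⋃ k : ℕ, signalDecidableSets (k : ℕ∞)) ⊂ DeltaTwoSets := by
  refine (ssubset_iff_of_subset (iUnion_subset fun k : ℕ =>
    signalDecidableSets_subset_deltaTwoSets k)).2 ⟨_, diagonalSet_mem_deltaTwoSets, fun h => ?_⟩
  obtain ⟨k, hk⟩ := mem_iUnion.1 h
  exact diagonalSet_notMem_signalDecidableSets k hk

theorem signalDecidableSets_ssubset_iff {B : ℕ∞} :
    signalDecidableSets B ⊂ DeltaTwoSets ↔ B ≠ ⊤ := by
  constructor
  · rintro h rfl
    exact h.ne signalDecidableSets_top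
  · intro h
    lift B to ℕ using h
    exact (subset_iUnion (fun k : ℕ => signalDecidableSets (k : ℕ∞)) B).trans_ssubset
      iUnion_signalDecidableSets_ssubset

theorem theoremB {M : Type*} [TopologicalSpace M] [ChartedSpace (EuclideanSpace ℝ (Fin 4)) M]
    [IsManifold (𝓡 4) ∞ M] (S : Spacetime M) (hS : S.IsMalamentHogarth) :
    -- whatever the bound `B` on the number of signals, only `Δ₂` relations are decidable, and
    -- they form a proper subclass if and only if the bound is finite
    (∀ B : ℕ∞, S.decidableSets B ⊆ DeltaTwoSets ∧
      (S.decidableSets B ⊂ DeltaTwoSets ↔ B ≠ ⊤)) ∧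
    -- the relations decidable with some fixed finite bound are the finite Boolean combinations
    -- of `Σ₁` (and `Π₁`) relations, and all of them together do not exhaust `Δ₂`
    (⋃ k : ℕ, S.decidableSets (k : ℕ∞)) = (BooleanSubalgebra.closure SigmaOneSets : Set (Set ℕ)) ∧
    (⋃ k : ℕ, S.decidableSets (k : ℕ∞)) ⊂ DeltaTwoSets ∧
    -- with finitely many but unboundedly many signals exactly the `Δ₂` relations are decidable,
    -- and these are the trial and error predicates
    S.decidableSets ⊤ = DeltaTwoSets ∧
    S.decidableSets ⊤ = {R | IsTrialAndError R} := by
  have hU : (⋃ k : ℕ, S.decidableSets (k : ℕ∞)) = ⋃ k : ℕ, signalDecidableSets (k : ℕ∞) :=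
    iUnion_congr fun k => hS.decidableSets_eq k
  rw [hU]
  simp only [hS.decidableSets_eq]
  exact ⟨fun B => ⟨signalDecidableSets_subset_deltaTwoSets B, signalDecidableSets_ssubset_iff⟩,
    iUnion_signalDecidableSets, iUnion_signalDecidableSets_ssubset, signalDecidableSets_top,
    signalDecidableSets_top.trans (Set.ext fun R =>
      ⟨isTrialAndError_of_mem_deltaTwoSets, mem_deltaTwoSets_of_isTrialAndError⟩)⟩
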